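/- **Setting.** Let $X$ be a set and $H\subseteq\{0,1\}^X$. The class $H$ shatters a finite set $S\subseteq X$ if every function $S\to\{0,1\}$ is the restriction of some $h\in H$, and $\mathrm{VC}(H)\in\mathbb N\cup\{\infty\}$ is the supremum of $|S|$ over the finite shattered sets $S$. In the agnostic transductive online game of length $n$, a sequence $x=(x_1,\dots,x_n)\in X^n$ is first announced to the learner. Then, in each round $t=1,\dots,n$, the adversary selects a label $y_t\in\{0,1\}$ (without restriction), the learner, who may randomize and who knows $x$ and $y_1,\dots,y_{t-1}$, predicts $\hat y_t\in\{0,1\}$, and $y_t$ is revealed. For a learner strategy $A$, put $$\mathrm{Reg}(A,H,x,y)=\mathbb E\,\bigl|\{t:\hat y_t\ne y_t\}\bigr|-\min_{h\in H}\bigl|\{t:h(x_t)\ne y_t\}\bigr|,\qquad \mathrm{Reg}(H,n)=\inf_A\ \sup_{x\in X^n}\ \sup_{y\in\{0,1\}^n}\mathrm{Reg}(A,H,x,y),$$ where the expectation is over the learner's randomness and the infimum is over all randomized learner strategies. **Theorem.** 1. There is a universal constant $c>0$ such that for every set $X$, every $H\subseteq\{0,1\}^X$ with $d=\mathrm{VC}(H)$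 satisfying $0<d<\infty$, and every $n\in\mathbb N$ with $d\le n\le|X|$, $$c\sqrt{d\,n}\ \le\ \mathrm{Reg}(H,n).$$ 2. For every real $a>1$ there is a constant $C>0$, depending only on $a$, such that for every set $X$, every $H\subseteq\{0,1\}^X$ with $d=\mathrm{VC}(H)$ satisfying $0<d<\infty$, and every $n\in\mathbb N$ with $a\,d\le n\le|X|$, $$\mathrm{Reg}(H,n)\ \le\ C\sqrt{d\,n\,\log(n/d)} .$$ -/

import Mathlib

universe u

namespace AgnosticTransductive

/-- `H` shatters the finite set `S`: every labeling of `S` is realized by some member of `H`. -/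
def Shatters {X : Type u} (H : Set (X → Bool)) (S : Finset X) : Prop :=
  ∀ y : S → Bool, ∃ h ∈ H, ∀ s : S, h s = y s

/-- The Vapnik--Chervonenkis dimension: the supremum in `ℕ ∪ {∞}` of the cardinalities of the
finite sets shattered by `H`. -/
noncomputable def vcDim {X : Type u} (H : Set (X → Bool)) : ℕ∞ :=
  ⨆ (S : Finset X) (_ : Shatters H S), (S.card : ℕ∞)

/-- A deterministic prediction rule for `n` rounds: at round `t` (rounds are numbered from `0`)
the prediction is a function of the labels revealed in the rounds before `t`.
(The past predictions of a deterministic learner are themselves functions of these labels.) -/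
abbrev PredictionRule (n : ℕ) : Type :=
  (t : Fin n) → (Fin t.val → Bool) → Bool

/-- The labels revealed before round `t`. -/
def pastLabels {n : ℕ} (y : Fin n → Bool) (t : Fin n) : Fin t.val → Bool :=
  fun s => y ⟨s.val, s.isLt.trans t.isLt⟩

/-- The number of rounds in which the rule `f` mispredicts the label, on the label sequence `y`. -/
def PredictionRule.mistakes {n : ℕ} (f : PredictionRule n) (y : Fin n → Bool) : ℕ :=
  (Finset.univ.filter fun t : Fin n => f t (pastLabels y t) ≠ y t).card

/-- A randomized learner strategy: the whole sequence of instances is announced in advance, and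
knowing it the learner plays according to a probability distribution over the (finitely many)
deterministic prediction rules. -/
abbrev Learner (X : Type u) (n : ℕ) : Type u :=
  (Fin n → X) → PMF (PredictionRule n)

/-- The expected number of mistakes of the learner, over its internal randomness, on instances `x`
and labels `y`. -/
noncomputable def Learner.expectedMistakes {X : Type u} {n : ℕ} (A : Learner X n)
    (x : Fin n → X) (y : Fin n → Bool) : ℝ :=
  ∑ f : PredictionRule n, (A x f).toReal * (f.mistakes y : ℝ)

/-- The number of mistakes of the fixed hypothesis `h`. -/
def hypothesisMistakes {X : Type u} {n : ℕ} (h : X → Bool) (x : Fin n → X) (y : Fin n → Bool) : ℕ :=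
  (Finset.univ.filter fun t : Fin n => h (x t) ≠ y t).card

/-- The number of mistakes of the best hypothesis of `H` (an infimum in `ℕ`, hence a minimum when
`H` is nonempty). -/
noncomputable def bestMistakes {X : Type u} {n : ℕ} (H : Set (X → Bool))
    (x : Fin n → X) (y : Fin n → Bool) : ℕ :=
  ⨅ h : H, hypothesisMistakes h.val x y

/-- The regret of the learner `A` with respect to `H`, on instances `x` and labels `y`. -/
noncomputable def Learner.regret {X : Type u} {n : ℕ} (A : Learner X n) (H : Set (X → Bool))
    (x : Fin n → X) (y : Fin n → Bool) : ℝ :=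
  A.expectedMistakes x y - (bestMistakes H x y : ℝ)

/-- The agnostic transductive regret of `H` on sequences of length `n`: the value of the game.
All the quantities involved lie in `[-n, n]`, by `Learner.abs_regret_le` below. -/
noncomputable def regret {X : Type u} (H : Set (X → Bool)) (n : ℕ) : ℝ :=
  ⨅ A : Learner X n, ⨆ x : Fin n → X, ⨆ y : Fin n → Bool, A.regret H x y

/-- The regret is bounded, so that the real suprema and infima in `regret` are genuine (the index
types being nonempty as soon as `X` is). -/
theorem Learner.abs_regret_le {X : Type u} {n : ℕ} (A : Learner X n) (H : Set (X → Bool))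
    (x : Fin n → X) (y : Fin n → Bool) : |A.regret H x y| ≤ n := by
  have hsum : ∑ f : PredictionRule n, (A x f).toReal = 1 := by
    rw [← ENNReal.toReal_sum (fun f _ => (A x).apply_ne_top f), ← tsum_fintype (L := .unconditional _),
      (A x).tsum_coe, ENNReal.toReal_one]
  have h1 : A.expectedMistakes x y ≤ n := by
    calc A.expectedMistakes x y
        ≤ ∑ f : PredictionRule n, (A x f).toReal * (n : ℝ) := by
          refine Finset.sum_le_sum fun f _ => mul_le_mul_of_nonneg_left ?_ ENNReal.toReal_nonneg
          have := Finset.card_filter_le (Finset.univ : Finset (Fin n))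
            (fun t => f t (pastLabels y t) ≠ y t)
          rw [Finset.card_univ, Fintype.card_fin] at this
          exact_mod_cast this
      _ = n := by rw [← Finset.sum_mul, hsum, one_mul]
  have h0 : 0 ≤ A.expectedMistakes x y :=
    Finset.sum_nonneg fun f _ => mul_nonneg ENNReal.toReal_nonneg (Nat.cast_nonneg _)
  have h2 : bestMistakes H x y ≤ n := by
    rcases isEmpty_or_nonempty H with hH | ⟨⟨h⟩⟩
    · simp [bestMistakes]
    · refine (ciInf_le (OrderBot.bddBelow _) h).trans ?_
      have := Finset.card_filter_le (Finset.univ : Finset (Fin n)) (fun t => h.val (x t) ≠ y t)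
      rwa [Finset.card_univ, Fintype.card_fin] at this
  have h2' : (bestMistakes H x y : ℝ) ≤ n := by exact_mod_cast h2
  have h3 : (0 : ℝ) ≤ bestMistakes H x y := Nat.cast_nonneg _
  rw [Learner.regret, abs_le]
  constructor <;> linarith

end AgnosticTransductive

/-! Lower bound: the instances cycle through the `d` points of a shattered set and the labels are
uniformly random. Every learner errs `n / 2` times on average (`sum_mistakes`). The hypothesis
taking the majority label at each point saves half the absolute sign sum of each block
(`bestMistakes_le_of_shatters`), on average at least a quarter of the root of the block length
(`le_sum_abs_signSum`). With `d` blocks of length about `n / d` the regret is of order `√(d n)`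
(`le_regret`).

Upper bound: since `x` is known in advance, `H` reduces to the finite set of its labelings of `x`.
By Sauer–Shelah there are at most `(e n / d) ^ d` of them (`card_patterns_le`, `sum_choose_le_exp`).
Exponential weights over these experts has regret at most `2 √(n B)`, where `B = d (1 + log (n /
d))` bounds the logarithm of their number (`exists_forecast_regret_le`, `regret_le`). When `n ≥ a d`
with `a > 1`, the summand `1` is absorbed into the logarithm. -/

namespace AgnosticTransductive

/-! ### Random labels, moments of sign sums and a Khintchine inequality. -/

/-- The sign `±1` of a label. -/
def sgn (b : Bool) : ℝ := if b then 1 else -1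

lemma sgn_not (b : Bool) : sgn (!b) = -sgn b := by cases b <;> simp [sgn]

lemma sgn_mul_self (b : Bool) : sgn b * sgn b = 1 := by cases b <;> simp [sgn]

lemma indicator_ne_eq (a b : Bool) :
    (if a ≠ b then (1 : ℝ) else 0) = (1 - sgn a * sgn b) / 2 := by
  cases a <;> cases b <;> norm_num [sgn]

/-- Flipping the label at `t` is a fixed-point-free involution that negates each term. -/
lemma sum_sgn_mul_eq_zero {n : ℕ} (t : Fin n) (F : (Fin n → Bool) → ℝ)
    (hF : ∀ y b, F (Function.update y t b) = F y) : ∑ y, sgn (y t) * F y = 0 := by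
  refine Finset.sum_involution (fun y _ => Function.update y t (!y t)) ?_ ?_ ?_ ?_
  · intro y _
    simp [hF, sgn_not]
  · intro y _ _ h
    have := congrFun h t
    simp at this
  · intro y _
    exact Finset.mem_univ _
  · intro y _
    simp

lemma pastLabels_update {n : ℕ} (y : Fin n → Bool) (t : Fin n) (b : Bool) :
    pastLabels (Function.update y t b) t = pastLabels y t := by
  funext s
  have : (⟨s.val, s.isLt.trans t.isLt⟩ : Fin n) ≠ t := fun h => by
    have := congrArg Fin.val h
    have := s.isLt
    simp at *
    omega
  simp [pastLabels, this]

lemma mistakes_eq {n : ℕ} (f : PredictionRule n) (y : Fin n → Bool) :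
    (f.mistakes y : ℝ) = ∑ t, (1 - sgn (y t) * sgn (f t (pastLabels y t))) / 2 := by
  rw [PredictionRule.mistakes, Finset.card_filter]
  push_cast
  exact Finset.sum_congr rfl fun t _ => by rw [indicator_ne_eq, mul_comm]

lemma hypothesisMistakes_eq {X : Type u} {n : ℕ} (h : X → Bool) (x : Fin n → X)
    (y : Fin n → Bool) :
    (hypothesisMistakes h x y : ℝ) = ∑ t, (1 - sgn (h (x t)) * sgn (y t)) / 2 := by
  rw [hypothesisMistakes, Finset.card_filter]
  push_cast
  exact Finset.sum_congr rfl fun t _ => indicator_ne_eq _ _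

/-- Against uniformly random labels every prediction rule errs half of the time. -/
lemma sum_mistakes {n : ℕ} (f : PredictionRule n) :
    ∑ y, (f.mistakes y : ℝ) = 2 ^ n * (n / 2) := by
  simp_rw [mistakes_eq]
  rw [Finset.sum_comm]
  have (t : Fin n) : ∑ y : Fin n → Bool, (1 - sgn (y t) * sgn (f t (pastLabels y t))) / 2
      = 2 ^ n / 2 := by
    rw [← Finset.sum_div, Finset.sum_sub_distrib,
      sum_sgn_mul_eq_zero t (fun y => sgn (f t (pastLabels y t)))
        (fun y b => by simp only [pastLabels_update])]
    simp
  simp only [this, Finset.sum_const, Finset.card_univ, Fintype.card_fin, nsmul_eq_mul]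
  ring

lemma sum_toReal_eq_one {α : Type*} [Fintype α] (p : PMF α) : ∑ a, (p a).toReal = 1 := by
  rw [← ENNReal.toReal_sum (fun a _ => p.apply_ne_top a),
    ← tsum_fintype (L := .unconditional _), p.tsum_coe, ENNReal.toReal_one]

lemma sum_expectedMistakes {X : Type u} {n : ℕ} (A : Learner X n) (x : Fin n → X) :
    ∑ y, A.expectedMistakes x y = 2 ^ n * (n / 2) := by
  simp_rw [Learner.expectedMistakes]
  rw [Finset.sum_comm]
  simp_rw [← Finset.mul_sum, sum_mistakes, ← Finset.sum_mul]
  rw [sum_toReal_eq_one, one_mul]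

/-- The sum of the signs of the labels over `T`. -/
def signSum {n : ℕ} (T : Finset (Fin n)) (y : Fin n → Bool) : ℝ := ∑ t ∈ T, sgn (y t)

lemma signSum_insert {n : ℕ} {T : Finset (Fin n)} {t : Fin n} (ht : t ∉ T) (y : Fin n → Bool) :
    signSum (insert t T) y = sgn (y t) + signSum T y := Finset.sum_insert ht

lemma signSum_update {n : ℕ} {T : Finset (Fin n)} {t : Fin n} (ht : t ∉ T) (y : Fin n → Bool)
    (b : Bool) : signSum T (Function.update y t b) = signSum T y :=
  Finset.sum_congr rfl fun s hs => by
    rw [Function.update_of_ne (ne_of_mem_of_not_mem hs ht)]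

lemma sum_signSum_sq {n : ℕ} (T : Finset (Fin n)) :
    ∑ y, signSum T y ^ 2 = 2 ^ n * T.card := by
  induction T using Finset.induction_on with
  | empty => simp [signSum]
  | insert t T ht ih =>
    have h (y : Fin n → Bool) : signSum (insert t T) y ^ 2
        = signSum T y ^ 2 + 1 + sgn (y t) * (2 * signSum T y) := by
      rw [signSum_insert ht]
      linear_combination sgn_mul_self (y t)
    simp_rw [h, Finset.sum_add_distrib]
    rw [ih, sum_sgn_mul_eq_zero t _ (fun y b => by rw [signSum_update ht]),
      Finset.card_insert_of_notMem ht]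
    simp
    ring

/-- Terms odd in the new sign cancel, and the induction closes by `3m² + 6m + 1 ≤ 3(m + 1)²`. -/
lemma sum_signSum_pow_four_le {n : ℕ} (T : Finset (Fin n)) :
    ∑ y, signSum T y ^ 4 ≤ 2 ^ n * (3 * (T.card : ℝ) ^ 2) := by
  induction T using Finset.induction_on with
  | empty => simp [signSum]
  | insert t T ht ih =>
    have h (y : Fin n → Bool) : signSum (insert t T) y ^ 4
        = signSum T y ^ 4 + 6 * signSum T y ^ 2 + 1
          + sgn (y t) * (4 * signSum T y ^ 3 + 4 * signSum T y) := by
      rw [signSum_insert ht]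
      linear_combination (sgn (y t) * sgn (y t) + 1 + 4 * sgn (y t) * signSum T y
        + 6 * signSum T y ^ 2) * sgn_mul_self (y t)
    simp_rw [h, Finset.sum_add_distrib]
    rw [← Finset.mul_sum, sum_signSum_sq,
      sum_sgn_mul_eq_zero t _ (fun y b => by rw [signSum_update ht]),
      Finset.card_insert_of_notMem ht]
    simp
    have : (0 : ℝ) < 2 ^ n := by positivity
    nlinarith

/-- A Khintchine inequality. -/
lemma le_sum_abs_signSum {n : ℕ} (T : Finset (Fin n)) :
    2 ^ n * (√T.card / 2) ≤ ∑ y, |signSum T y| := by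
  rcases T.eq_empty_or_nonempty with rfl | hT
  · simp [signSum]
  have hr0 : 0 < √(T.card : ℝ) := Real.sqrt_pos.2 (by exact_mod_cast hT.card_pos)
  have hr2 : (T.card : ℝ) = √(T.card : ℝ) ^ 2 := (Real.sq_sqrt (Nat.cast_nonneg _)).symm
  generalize √(T.card : ℝ) = r at hr0 hr2 ⊢
  -- A minorant of `|s|` using only the second and fourth moments. With `v = |s| / r` it says `3v/4
  -- - v³/12 ≤ 1`; the left side is largest at `v = √3`, close to the `7 / 4` used below.
  have key (s : ℝ) : 3 / 4 / r * s ^ 2 - 1 / 12 / r ^ 3 * s ^ 4 ≤ |s| := by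
    obtain ⟨v, hv⟩ : ∃ v, |s| = r * v := ⟨|s| / r, by field_simp⟩
    have hv0 : 0 ≤ v := by
      by_contra! h
      nlinarith [abs_nonneg s]
    have h4 : s ^ 4 = (r * v) ^ 4 := by rw [← hv]; exact (Even.pow_abs ⟨2, rfl⟩ s).symm
    rw [← sq_abs s, h4, hv]
    have h : 3 / 4 / r * (r * v) ^ 2 - 1 / 12 / r ^ 3 * (r * v) ^ 4
        = r * v * (3 / 4 * v - 1 / 12 * v ^ 3) := by field_simp
    rw [h]
    refine mul_le_of_le_one_right (by positivity) ?_
    nlinarith [mul_nonneg (sq_nonneg (v - 7 / 4)) hv0, sq_nonneg (v - 7 / 4)]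
  calc 2 ^ n * (r / 2) = 3 / 4 / r * (2 ^ n * r ^ 2)
        - 1 / 12 / r ^ 3 * (2 ^ n * (3 * (r ^ 2) ^ 2)) := by field_simp; ring
    _ ≤ 3 / 4 / r * ∑ y, signSum T y ^ 2 - 1 / 12 / r ^ 3 * ∑ y, signSum T y ^ 4 := by
        have := sum_signSum_pow_four_le T
        rw [sum_signSum_sq]
        rw [hr2] at this ⊢
        gcongr
    _ ≤ _ := by
        rw [Finset.mul_sum, Finset.mul_sum, ← Finset.sum_sub_distrib]
        exact Finset.sum_le_sum fun y _ => key _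

/-! ### The best hypothesis on repeated points of a shattered set. -/

lemma bestMistakes_le {X : Type u} {n : ℕ} {H : Set (X → Bool)} {h : X → Bool} (hh : h ∈ H)
    (x : Fin n → X) (y : Fin n → Bool) : bestMistakes H x y ≤ hypothesisMistakes h x y :=
  ciInf_le (OrderBot.bddBelow _) (⟨h, hh⟩ : H)

-- Shattering provides a hypothesis that follows the majority label in every block.
open Classical in
lemma bestMistakes_le_of_shatters {X : Type u} {n : ℕ} {H : Set (X → Bool)} {S : Finset X}
    (hS : Shatters H S) (g : Fin n → S) (y : Fin n → Bool) :
    (bestMistakes H (fun t => (g t : X)) y : ℝ)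
      ≤ n / 2 - (∑ s : S, |signSum (Finset.univ.filter (g · = s)) y|) / 2 := by
  obtain ⟨h, hh, hy⟩ := hS fun s => decide (0 ≤ signSum (Finset.univ.filter (g · = s)) y)
  refine (Nat.cast_le.2 (bestMistakes_le hh _ y)).trans_eq ?_
  rw [hypothesisMistakes_eq, ← Finset.sum_div, Finset.sum_sub_distrib,
    ← Finset.sum_fiberwise_of_maps_to (s := Finset.univ) (t := Finset.univ) (g := g)
      (fun _ _ => Finset.mem_univ _) (fun t => sgn (h (g t)) * sgn (y t))]
  have (s : S) : ∑ t with g t = s, sgn (h (g t)) * sgn (y t)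
      = |signSum (Finset.univ.filter (g · = s)) y| := by
    rw [Finset.sum_congr rfl (g := fun t => sgn (h s) * sgn (y t)) fun t ht => by
      rw [(Finset.mem_filter.1 ht).2], ← Finset.mul_sum, hy]
    change _ * signSum _ y = _
    by_cases h0 : 0 ≤ signSum (Finset.univ.filter (g · = s)) y
    · simp [sgn, h0, abs_of_nonneg]
    · simp [sgn, h0, abs_of_neg (not_le.1 h0)]
  simp only [this, Finset.sum_const, Finset.card_univ, Fintype.card_fin, nsmul_eq_mul]
  ring

/-- Round-robin assignment `t ↦ t % d`: the rounds `k * d + i` with `k < n / d` all land on `i`. -/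
lemma exists_fibers_card_ge {ι : Type*} [Fintype ι] [DecidableEq ι] {d n : ℕ}
    (hd : Fintype.card ι = d) (hd0 : 0 < d) :
    ∃ g : Fin n → ι, ∀ i, n / d ≤ (Finset.univ.filter (g · = i)).card := by
  let e := Fintype.equivFinOfCardEq hd
  refine ⟨fun t => e.symm ⟨t % d, Nat.mod_lt _ hd0⟩, fun i => ?_⟩
  have hlt (k : Fin (n / d)) : k * d + e i < n := by
    have h1 : (k.val + 1) * d ≤ n / d * d := Nat.mul_le_mul_right _ k.isLt
    have h2 := Nat.div_mul_le_self n d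
    have h3 := (e i).isLt
    rw [Nat.add_mul] at h1
    omega
  calc n / d = (Finset.univ : Finset (Fin (n / d))).card := by simp
    _ ≤ _ := Finset.card_le_card_of_injOn (fun k => ⟨k * d + e i, hlt k⟩)
      (fun k _ => by simp [e.symm_apply_eq, Fin.ext_iff, Nat.mod_eq_of_lt (e i).isLt])
      (fun k _ l _ h => by
        have := congrArg Fin.val h
        simp at this
        rcases this with h | h
        · exact Fin.ext h
        · omega)

lemma exists_shatters_of_vcDim {X : Type u} {H : Set (X → Bool)} {d : ℕ}
    (h : vcDim H = (d : ℕ∞)) (hd : 0 < d) : ∃ S : Finset X, Shatters H S ∧ S.card = d := by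
  by_contra! hne
  have : vcDim H ≤ ((d - 1 : ℕ) : ℕ∞) := iSup₂_le fun S hS => by
    have h1 : (S.card : ℕ∞) ≤ d := h ▸ le_iSup₂ (f := fun (S : Finset X) (_ : Shatters H S) =>
      (S.card : ℕ∞)) S hS
    have h2 : S.card ≤ d := by exact_mod_cast h1
    have := hne S hS
    exact_mod_cast (by omega : S.card ≤ d - 1)
  rw [h] at this
  have : d ≤ d - 1 := by exact_mod_cast this
  omega

/-! ### The value of the game, and the lower bound. -/

lemma Learner.regret_le_iSup {X : Type u} {n : ℕ} (A : Learner X n) (H : Set (X → Bool))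
    (x : Fin n → X) (y : Fin n → Bool) : A.regret H x y ≤ ⨆ x, ⨆ y, A.regret H x y := by
  have hb (x : Fin n → X) : BddAbove (Set.range fun y => A.regret H x y) :=
    ⟨n, by rintro _ ⟨y, rfl⟩; exact (abs_le.1 (A.abs_regret_le H x y)).2⟩
  refine (le_ciSup (hb x) y).trans (le_ciSup (f := fun x => ⨆ y, A.regret H x y) ?_ x)
  exact ⟨n, by rintro _ ⟨x, rfl⟩; exact ciSup_le fun y => (abs_le.1 (A.abs_regret_le H x y)).2⟩

lemma regret_le_of_learner {X : Type u} [Nonempty X] {n : ℕ} (A : Learner X n)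
    (H : Set (X → Bool)) {B : ℝ} (hA : ∀ x y, A.regret H x y ≤ B) : regret H n ≤ B := by
  refine (ciInf_le ⟨-(n : ℝ), ?_⟩ A).trans (ciSup_le fun x => ciSup_le (hA x))
  rintro _ ⟨A, rfl⟩
  let x : Fin n → X := fun _ => Classical.arbitrary X
  exact (abs_le.1 (A.abs_regret_le H x fun _ => true)).1.trans (A.regret_le_iSup H _ _)

/-- Some label sequence does at least as badly as the average over all `2 ^ n` of them, so it
suffices to bound that average. -/
theorem le_regret {X : Type u} {H : Set (X → Bool)} {d n : ℕ} (hH : vcDim H = (d : ℕ∞))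
    (hd : 0 < d) (hn : d ≤ n) : 1 / 8 * √((d : ℝ) * n) ≤ regret H n := by
  classical
  obtain ⟨S, hS, hcard⟩ := exists_shatters_of_vcDim hH hd
  obtain ⟨g, hg⟩ := exists_fibers_card_ge (ι := S) (n := n) (by simpa using hcard) hd
  have : Nonempty (Learner X n) := ⟨fun _ => PMF.pure fun _ _ => true⟩
  refine le_ciInf fun A => ?_
  by_contra! hlt
  have hreg (y : Fin n → Bool) : A.regret H (fun t => (g t : X)) y < 1 / 8 * √((d : ℝ) * n) :=
    (A.regret_le_iSup H _ y).trans_lt hlt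
  have hd' : (0 : ℝ) < d := by exact_mod_cast hd
  have hdiv : (n : ℝ) / (4 * d) ≤ (n / d : ℕ) := by
    have h1 : 1 ≤ n / d := Nat.div_pos hn hd
    have h2 : n < d * (n / d + 1) := Nat.lt_mul_div_succ n hd
    have h3 : n ≤ 4 * d * (n / d) := by nlinarith
    rw [div_le_iff₀ (by positivity), mul_comm]
    exact_mod_cast h3
  -- Each block has length at least `n / (4d)`, whose root is `√(d n) / (2d)`; Khintchine halves it.
  -- Summing `d` blocks and halving again gives the constant `1 / 8`.
  have hblock (s : S) : 2 ^ n * (√((d : ℝ) * n) / (4 * d))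
      ≤ ∑ y, |signSum (Finset.univ.filter (g · = s)) y| := by
    refine le_trans ?_ (le_sum_abs_signSum _)
    have h1 : √((d : ℝ) * n) / (2 * d) ≤ √((Finset.univ.filter (g · = s)).card : ℝ) := by
      apply Real.le_sqrt_of_sq_le
      rw [div_pow, Real.sq_sqrt (by positivity)]
      refine le_trans (le_of_eq ?_) (hdiv.trans (by exact_mod_cast hg s))
      field_simp
      norm_num
    have h2 : √((d : ℝ) * n) / (4 * d) = √((d : ℝ) * n) / (2 * d) / 2 := by field_simp; norm_num
    rw [h2]
    gcongr
  have hsum : ∑ y, A.regret H (fun t => (g t : X)) y < 2 ^ n * (1 / 8 * √((d : ℝ) * n)) := by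
    refine (Finset.sum_lt_sum_of_nonempty Finset.univ_nonempty fun y _ => hreg y).trans_eq ?_
    simp
  have hge : 2 ^ n * (1 / 8 * √((d : ℝ) * n)) ≤ ∑ y, A.regret H (fun t => (g t : X)) y := by
    calc 2 ^ n * (1 / 8 * √((d : ℝ) * n))
        = (∑ _s : S, 2 ^ n * (√((d : ℝ) * n) / (4 * d))) / 2 := by
          rw [Finset.sum_const, Finset.card_univ, Fintype.card_coe, hcard, nsmul_eq_mul]
          generalize √((d : ℝ) * n) = q
          field_simp
          ring
      _ ≤ (∑ s : S, ∑ y, |signSum (Finset.univ.filter (g · = s)) y|) / 2 := by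
          gcongr with s _
          exact hblock s
      _ = ∑ y, A.expectedMistakes (fun t => (g t : X)) y
          - ∑ y : Fin n → Bool,
            (n / 2 - (∑ s : S, |signSum (Finset.univ.filter (g · = s)) y|) / 2) := by
          rw [sum_expectedMistakes, Finset.sum_sub_distrib, Finset.sum_comm, ← Finset.sum_div]
          simp only [← Finset.sum_div, Finset.sum_const, Finset.card_univ, Fintype.card_fun, Fintype.card_bool,
            Fintype.card_fin, nsmul_eq_mul]
          push_cast
          ring
      _ ≤ _ := by
          rw [← Finset.sum_sub_distrib]
          exact Finset.sum_le_sum fun y _ =>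
            sub_le_sub_left (bestMistakes_le_of_shatters hS g y) _
  exact absurd hge (not_le.2 hsum)

/-! ### Realizing a probability forecast by a randomized learner. -/

open MeasureTheory

/-- The prediction rule that predicts `true` whenever its estimated probability exceeds `r`. -/
noncomputable def thresholdRule {n : ℕ} (p : (t : Fin n) → (Fin t.val → Bool) → ℝ) (r : ℝ) :
    PredictionRule n := fun t u => decide (r < p t u)

lemma measurable_thresholdRule {n : ℕ} (p : (t : Fin n) → (Fin t.val → Bool) → ℝ) :
    Measurable (thresholdRule p) := by
  refine measurable_to_countable' fun f => ?_
  have : thresholdRule p ⁻¹' {f} = ⋂ t, ⋂ u, {r | decide (r < p t u) = f t u} := by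
    ext r
    simp [thresholdRule, funext_iff]
  rw [this]
  refine MeasurableSet.iInter fun t => MeasurableSet.iInter fun u => ?_
  cases f t u
  · simpa only [decide_eq_false_iff_not, not_lt] using measurableSet_le measurable_const measurable_id'
  · simpa only [decide_eq_true_eq] using measurableSet_lt measurable_id' measurable_const

/-- The uniform distribution on the unit interval. -/
noncomputable def unitUniform : Measure ℝ := volume.restrict (Set.Ico 0 1)

instance : IsProbabilityMeasure unitUniform := ⟨by simp [unitUniform]⟩

lemma unitUniform_real_Iio {p : ℝ} (h0 : 0 ≤ p) (h1 : p ≤ 1) :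
    unitUniform.real (Set.Iio p) = p := by
  have : Set.Iio p ∩ Set.Ico 0 1 = Set.Ico 0 p := by
    ext r
    simp
    constructor
    · rintro ⟨a, b, c⟩
      exact ⟨b, a⟩
    · rintro ⟨a, b⟩
      exact ⟨b, a, b.trans_le h1⟩
  rw [measureReal_def, unitUniform, Measure.restrict_apply measurableSet_Iio, this]
  simp [h0]

/-- The distribution of the threshold rule with a uniformly random threshold. -/
noncomputable def thresholdPMF {n : ℕ} (p : (t : Fin n) → (Fin t.val → Bool) → ℝ) :
    PMF (PredictionRule n) :=
  have := Measure.isProbabilityMeasure_map (μ := unitUniform)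
    (measurable_thresholdRule p).aemeasurable
  (unitUniform.map (thresholdRule p)).toPMF

lemma sum_thresholdPMF_mul {n : ℕ} (p : (t : Fin n) → (Fin t.val → Bool) → ℝ)
    (F : PredictionRule n → ℝ) :
    ∑ f, (thresholdPMF p f).toReal * F f = ∫ r, F (thresholdRule p r) ∂unitUniform := by
  have := Measure.isProbabilityMeasure_map (μ := unitUniform)
    (measurable_thresholdRule p).aemeasurable
  rw [← integral_map (measurable_thresholdRule p).aemeasurable
    (Measurable.of_discrete (f := F)).aestronglyMeasurable,
    integral_fintype (Integrable.of_finite)]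
  rfl

/-- By linearity of expectation only the marginal law of each prediction matters, so a single
threshold shared by all rounds suffices. -/
lemma sum_thresholdPMF_mistakes {n : ℕ} {p : (t : Fin n) → (Fin t.val → Bool) → ℝ}
    (h0 : ∀ t u, 0 ≤ p t u) (h1 : ∀ t u, p t u ≤ 1) (y : Fin n → Bool) :
    ∑ f, (thresholdPMF p f).toReal * (f.mistakes y : ℝ)
      = ∑ t, if y t then 1 - p t (pastLabels y t) else p t (pastLabels y t) := by
  simp_rw [PredictionRule.mistakes, Finset.card_filter]
  push_cast
  simp_rw [Finset.mul_sum]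
  rw [Finset.sum_comm]
  refine Finset.sum_congr rfl fun t _ => ?_
  rw [sum_thresholdPMF_mul p fun f => if f t (pastLabels y t) ≠ y t then (1 : ℝ) else 0]
  set q := p t (pastLabels y t) with hq
  have hreal : unitUniform.real (Set.Iio q) = q := unitUniform_real_Iio (h0 _ _) (h1 _ _)
  cases y t
  · have : (fun r => if thresholdRule p r t (pastLabels y t) ≠ false then (1 : ℝ) else 0)
        = (Set.Iio q).indicator 1 := by
      ext r
      simp [thresholdRule, Set.indicator_apply, hq]
    rw [this, integral_indicator_one measurableSet_Iio, hreal]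
    simp
  · have : (fun r => if thresholdRule p r t (pastLabels y t) ≠ true then (1 : ℝ) else 0)
        = (Set.Iio q)ᶜ.indicator 1 := by
      ext r
      simp [thresholdRule, Set.indicator_apply, hq]
    rw [this, integral_indicator_one measurableSet_Iio.compl,
      probReal_compl_eq_one_sub measurableSet_Iio, hreal]
    simp

/-! ### Exponential weights. -/

/-- The factor by which the expert `v` is discounted in round `s`. -/
noncomputable def discount {n : ℕ} (η : ℝ) (v y : Fin n → Bool) (s : ℕ) : ℝ :=
  if h : s < n then if v ⟨s, h⟩ ≠ y ⟨s, h⟩ then Real.exp (-η) else 1 else 1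

/-- The weight of the expert `v` after the labels `u`. -/
noncomputable def expertWeight {n : ℕ} (η : ℝ) (v : Fin n → Bool) (t : Fin n)
    (u : Fin t.val → Bool) : ℝ :=
  ∏ s : Fin t.val, if v ⟨s.val, s.isLt.trans t.isLt⟩ ≠ u s then Real.exp (-η) else 1

/-- The exponentially weighted average of the experts in `V` that predict `true`. -/
noncomputable def weightedForecast {n : ℕ} (V : Finset (Fin n → Bool)) (η : ℝ) (t : Fin n)
    (u : Fin t.val → Bool) : ℝ :=
  (∑ v ∈ V, if v t then expertWeight η v t u else 0) / ∑ v ∈ V, expertWeight η v t u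

lemma expertWeight_pos {n : ℕ} (η : ℝ) (v : Fin n → Bool) (t : Fin n) (u : Fin t.val → Bool) :
    0 < expertWeight η v t u :=
  Finset.prod_pos fun s _ => by split_ifs <;> positivity

lemma expertWeight_pastLabels {n : ℕ} (η : ℝ) (v y : Fin n → Bool) (t : Fin n) :
    expertWeight η v t (pastLabels y t) = ∏ s ∈ Finset.range t, discount η v y s := by
  rw [Finset.prod_range]
  exact Finset.prod_congr rfl fun s _ => by
    rw [discount, dif_pos (s.isLt.trans t.isLt)]
    rfl

lemma weightedForecast_nonneg {n : ℕ} (V : Finset (Fin n → Bool)) (η : ℝ) (t : Fin n)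
    (u : Fin t.val → Bool) : 0 ≤ weightedForecast V η t u :=
  div_nonneg (Finset.sum_nonneg fun v _ => by
    have := (expertWeight_pos η v t u).le
    split_ifs <;> simp [this]) (Finset.sum_nonneg fun v _ => (expertWeight_pos η v t u).le)

lemma weightedForecast_le_one {n : ℕ} (V : Finset (Fin n → Bool)) (η : ℝ) (t : Fin n)
    (u : Fin t.val → Bool) : weightedForecast V η t u ≤ 1 :=
  div_le_one_of_le₀ (Finset.sum_le_sum fun v _ => by
    have := (expertWeight_pos η v t u).le
    split_ifs <;> simp [this]) (Finset.sum_nonneg fun v _ => (expertWeight_pos η v t u).le)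

/-- The probability of error in round `t` of a learner predicting `true` with probability `p`. -/
def roundError {n : ℕ} (p : (t : Fin n) → (Fin t.val → Bool) → ℝ) (y : Fin n → Bool)
    (t : Fin n) : ℝ :=
  if y t then 1 - p t (pastLabels y t) else p t (pastLabels y t)

/-- The erring experts hold a fraction `roundError` of the total weight and lose the factor `exp
(-η)`; then `1 - z ≤ exp (-z)`. -/
lemma sum_weight_succ_le {n : ℕ} {V : Finset (Fin n → Bool)} (hV : V.Nonempty) (η : ℝ)
    (y : Fin n → Bool) (t : Fin n) :
    ∑ v ∈ V, ∏ s ∈ Finset.range (t + 1), discount η v y s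
      ≤ (∑ v ∈ V, ∏ s ∈ Finset.range t, discount η v y s)
        * Real.exp (-((1 - Real.exp (-η)) * roundError (weightedForecast V η) y t)) := by
  simp_rw [Finset.prod_range_succ, ← expertWeight_pastLabels]
  set w := fun v : Fin n → Bool => expertWeight η v t (pastLabels y t) with hw
  have hpos : 0 < ∑ v ∈ V, w v := Finset.sum_pos (fun v _ => expertWeight_pos η v t _) hV
  have herr : (∑ v ∈ V, w v) * roundError (weightedForecast V η) y t
      = ∑ v ∈ V, if v t ≠ y t then w v else 0 := by
    have hf : (∑ v ∈ V, w v) * weightedForecast V η t (pastLabels y t)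
        = ∑ v ∈ V, if v t then w v else 0 := mul_div_cancel₀ _ hpos.ne'
    cases h : y t
    · simp only [roundError, h, Bool.false_eq_true, if_false, hf]
      simp
    · simp only [roundError, h, if_true, mul_sub, mul_one, hf]
      rw [← Finset.sum_sub_distrib]
      exact Finset.sum_congr rfl fun v _ => by cases v t <;> simp
  calc ∑ v ∈ V, w v * discount η v y t
      = ∑ v ∈ V, (w v - (1 - Real.exp (-η)) * if v t ≠ y t then w v else 0) :=
        Finset.sum_congr rfl fun v _ => by
          by_cases h : v t = y t <;> simp [discount, h]
          ring
    _ = (∑ v ∈ V, w v) * (1 - (1 - Real.exp (-η)) * roundError (weightedForecast V η) y t) := by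
        rw [Finset.sum_sub_distrib, ← Finset.mul_sum, ← herr]
        ring
    _ ≤ _ := by
        refine mul_le_mul_of_nonneg_left ?_ hpos.le
        have := Real.add_one_le_exp
          (-((1 - Real.exp (-η)) * roundError (weightedForecast V η) y t))
        linarith

lemma sum_weight_le {n : ℕ} {V : Finset (Fin n → Bool)} (hV : V.Nonempty) (η : ℝ)
    (y : Fin n → Bool) :
    ∑ v ∈ V, ∏ s ∈ Finset.range n, discount η v y s
      ≤ V.card * Real.exp (-((1 - Real.exp (-η)) * ∑ t, roundError (weightedForecast V η) y t)) := by
  set e : ℕ → ℝ := fun s => if h : s < n then roundError (weightedForecast V η) y ⟨s, h⟩ else 0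
  have key (k : ℕ) (hk : k ≤ n) : ∑ v ∈ V, ∏ s ∈ Finset.range k, discount η v y s
      ≤ V.card * Real.exp (-((1 - Real.exp (-η)) * ∑ s ∈ Finset.range k, e s)) := by
    induction k with
    | zero => simp
    | succ k ih =>
      have hkn : k < n := hk
      refine (sum_weight_succ_le hV η y ⟨k, hkn⟩).trans ?_
      rw [Finset.sum_range_succ, mul_add, neg_add, Real.exp_add, ← mul_assoc]
      have : e k = roundError (weightedForecast V η) y ⟨k, hkn⟩ := by simp [e, hkn]
      rw [this]
      exact mul_le_mul_of_nonneg_right (ih hkn.le) (Real.exp_pos _).le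
  have := key n le_rfl
  rwa [Finset.sum_range e, Finset.sum_congr rfl fun (t : Fin n) _ => dif_pos t.isLt] at this

/-- The exponential weights bound. -/
lemma exp_weights_bound {n : ℕ} {V : Finset (Fin n → Bool)} (η : ℝ)
    {v : Fin n → Bool} (hv : v ∈ V) (y : Fin n → Bool) :
    (1 - Real.exp (-η)) * ∑ t, roundError (weightedForecast V η) y t
      ≤ η * hypothesisMistakes v id y + Real.log V.card := by
  have hV : V.Nonempty := ⟨v, hv⟩
  have h1 : Real.exp (-η * hypothesisMistakes v id y)
      = ∏ s ∈ Finset.range n, discount η v y s := by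
    rw [Finset.prod_range, mul_comm, Real.exp_nat_mul, hypothesisMistakes,
      ← Finset.prod_const, Finset.prod_filter]
    exact Finset.prod_congr rfl fun s _ => by simp [discount]
  -- The final weight of the single expert `v` bounds the total weight from below; comparison with
  -- `sum_weight_le` and logarithms give the claim.
  have h2 : ∏ s ∈ Finset.range n, discount η v y s
      ≤ ∑ v ∈ V, ∏ s ∈ Finset.range n, discount η v y s :=
    Finset.single_le_sum (f := fun v => ∏ s ∈ Finset.range n, discount η v y s)
      (fun v _ => Finset.prod_nonneg fun s _ => by
        unfold discount
        split_ifs <;> positivity) hv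
  have h3 := h1.trans_le (h2.trans (sum_weight_le hV η y))
  have hc : (0 : ℝ) < V.card := by exact_mod_cast hV.card_pos
  rw [← Real.exp_log hc, ← Real.exp_add, Real.exp_le_exp] at h3
  linarith

lemma roundError_le_one {n : ℕ} {p : (t : Fin n) → (Fin t.val → Bool) → ℝ}
    (h0 : ∀ t u, 0 ≤ p t u) (h1 : ∀ t u, p t u ≤ 1) (y : Fin n → Bool) (t : Fin n) :
    roundError p y t ≤ 1 := by
  unfold roundError
  split_ifs
  · linarith [h0 t (pastLabels y t)]
  · exact h1 _ _

/-- With a finite set of experts of cardinality at most `exp B`, some randomized strategy has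
regret at most `2 * √(n * B)`. -/
lemma exists_forecast_regret_le {n : ℕ} (V : Finset (Fin n → Bool)) {B : ℝ}
    (hB : 0 < B) (hVB : Real.log V.card ≤ B) :
    ∃ P : PMF (PredictionRule n), ∀ v ∈ V, ∀ y,
      ∑ f, (P f).toReal * (f.mistakes y : ℝ) - hypothesisMistakes v id y ≤ 2 * √(n * B) := by
  refine ⟨thresholdPMF (weightedForecast V √(B / n)), fun v hv y => ?_⟩
  rw [sum_thresholdPMF_mistakes (weightedForecast_nonneg V _) (weightedForecast_le_one V _)]
  change ∑ t, roundError (weightedForecast V √(B / n)) y t - _ ≤ _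
  have hw := exp_weights_bound √(B / n) hv y
  have hMn : ∑ t, roundError (weightedForecast V √(B / n)) y t ≤ n := by
    refine (Finset.sum_le_sum fun t _ => roundError_le_one
      (weightedForecast_nonneg V _) (weightedForecast_le_one V _) y t).trans_eq ?_
    simp
  have hM0 : 0 ≤ ∑ t, roundError (weightedForecast V √(B / n)) y t :=
    Finset.sum_nonneg fun t _ => by
      unfold roundError
      split_ifs
      · exact sub_nonneg.2 (weightedForecast_le_one V _ _ _)
      · exact weightedForecast_nonneg V _ _ _
  generalize ∑ t, roundError (weightedForecast V √(B / n)) y t = M at *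
  have hL : (0 : ℝ) ≤ hypothesisMistakes v id y := Nat.cast_nonneg _
  generalize (hypothesisMistakes v id y : ℝ) = L at *
  -- If `n ≤ B`, which covers `n = 0`, the trivial bound `n` suffices. Otherwise `η = √(B / n) ≤ 1`,
  -- so `exp (-η) ≤ 1 - η + η²`; as `B = η² n` and `M ≤ n`, this yields `M - L ≤ 2 η n`.
  rcases le_or_gt (n : ℝ) B with h | h
  · have : (n : ℝ) ≤ √(n * B) := Real.le_sqrt_of_sq_le (by nlinarith [Nat.cast_nonneg (α := ℝ) n])
    linarith
  · have hn : (0 : ℝ) < n := hB.trans h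
    have hη : 0 < √(B / n) := Real.sqrt_pos.2 (by positivity)
    have hη1 : √(B / n) ≤ 1 := Real.sqrt_le_one.2 ((div_le_one hn).2 h.le)
    have hsq : √(B / n) ^ 2 * n = B := by rw [Real.sq_sqrt (by positivity)]; field_simp
    have hprod : √(n * B) = √(B / n) * n := by
      rw [show (n : ℝ) * B = (√(B / n) * n) ^ 2 by rw [← mul_right_inj' hn.ne'] at hsq; linarith,
        Real.sqrt_sq (by positivity)]
    rw [hprod]
    generalize √(B / n) = η at *
    have hexp : Real.exp (-η) ≤ 1 - η + η ^ 2 := by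
      have := (abs_le.1 (Real.abs_exp_sub_one_sub_id_le (x := -η)
        (by rw [abs_neg, abs_of_pos hη]; exact hη1))).2
      linarith [neg_sq η]
    have h1 : (η - η ^ 2) * M ≤ η * L + η ^ 2 * n :=
      (mul_le_mul_of_nonneg_right (by linarith) hM0).trans (hw.trans (by linarith))
    have h2 : η * (M - L) ≤ η * (2 * (η * n)) := by
      nlinarith [mul_le_mul_of_nonneg_left hMn (sq_nonneg η)]
    exact le_of_mul_le_mul_left h2 hη

/-! ### Counting the labelings of a sequence by `H`. -/

open Classical in
/-- The labelings of the sequence `x` by members of `H`. -/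
noncomputable def patterns {X : Type u} {n : ℕ} (H : Set (X → Bool)) (x : Fin n → X) :
    Finset (Fin n → Bool) :=
  Finset.univ.filter fun v => ∃ h ∈ H, h ∘ x = v

open Classical in
lemma comp_mem_patterns {X : Type u} {n : ℕ} {H : Set (X → Bool)} {h : X → Bool} (hh : h ∈ H)
    (x : Fin n → X) : h ∘ x ∈ patterns H x :=
  Finset.mem_filter.2 ⟨Finset.mem_univ _, h, hh, rfl⟩

lemma patterns_nonempty {X : Type u} {n : ℕ} {H : Set (X → Bool)} (hH : H.Nonempty)
    (x : Fin n → X) : (patterns H x).Nonempty :=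
  ⟨_, comp_mem_patterns hH.some_mem x⟩

/-- Instances may repeat, but not on a shattered index set: a labeling true at only one of its
indices separates that index from the rest. So its image in `X` is shattered and has the same size.
-/
lemma card_le_of_shatters_patterns {X : Type u} {n d : ℕ} {H : Set (X → Bool)} {x : Fin n → X}
    (hH : vcDim H = (d : ℕ∞)) {S : Finset (Fin n)}
    (hS : ((patterns H x).image fun v => Finset.univ.filter (v · = true)).Shatters S) :
    S.card ≤ d := by
  classical
  have hex (q : Fin n → Prop) : ∃ h ∈ H, ∀ s ∈ S, h (x s) = true ↔ q s := by
    obtain ⟨u, hu, hSu⟩ := hS (Finset.filter_subset q S)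
    obtain ⟨v, hv, rfl⟩ := Finset.mem_image.1 hu
    obtain ⟨h, hh, rfl⟩ := (Finset.mem_filter.1 hv).2
    refine ⟨h, hh, fun s hs => ?_⟩
    have := Finset.ext_iff.1 hSu s
    simpa [hs] using this
  have hinj : Set.InjOn x S := fun s hs s' hs' hxx => by
    obtain ⟨h, -, hh⟩ := hex (· = s)
    have := (hh s hs).2 rfl
    rw [hxx] at this
    exact ((hh s' hs').1 this).symm
  have hsh : Shatters H (S.image x) := fun y => by
    obtain ⟨h, hH, hh⟩ := hex fun s => ∃ hs : x s ∈ S.image x, y ⟨x s, hs⟩ = true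
    refine ⟨h, hH, ?_⟩
    rintro ⟨z, hz⟩
    obtain ⟨s, hs, rfl⟩ := Finset.mem_image.1 hz
    have := hh s hs
    simp only [hz, exists_true_left] at this
    exact Bool.eq_iff_iff.2 this
  have h1 : ((S.image x).card : ℕ∞) ≤ d := hH ▸ le_iSup₂
    (f := fun (S : Finset X) (_ : Shatters H S) => (S.card : ℕ∞)) (S.image x) hsh
  rw [Finset.card_image_of_injOn hinj] at h1
  exact_mod_cast h1

/-- The Sauer--Shelah lemma. -/
lemma card_patterns_le {X : Type u} {n d : ℕ} {H : Set (X → Bool)} (x : Fin n → X)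
    (hH : vcDim H = (d : ℕ∞)) : (patterns H x).card ≤ ∑ k ∈ Finset.Iic d, n.choose k := by
  classical
  set 𝒜 := (patterns H x).image fun v => Finset.univ.filter (v · = true)
  have hcard : 𝒜.card = (patterns H x).card := Finset.card_image_of_injective _ fun v w h => by
    funext t
    have := Finset.ext_iff.1 h t
    simp only [Finset.mem_filter, Finset.mem_univ, true_and] at this
    exact Bool.eq_iff_iff.2 this
  have hvc : 𝒜.vcDim ≤ d := Finset.sup_le fun S hS =>
    card_le_of_shatters_patterns hH (Finset.mem_shatterer.1 hS)
  rw [← hcard]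
  refine 𝒜.card_le_card_shatterer.trans (Finset.card_shatterer_le_sum_vcDim.trans ?_)
  rw [Fintype.card_fin]
  exact Finset.sum_le_sum_of_subset (Finset.Iic_subset_Iic.2 hvc)

/-- Since `d / n ≤ 1`, weighting the `k`-th term by `(d / n) ^ k` instead of `(d / n) ^ d` only
increases the sum, and the binomial theorem bounds it by `(1 + d / n) ^ n ≤ exp d`. -/
lemma sum_choose_le_exp {n d : ℕ} (hd : 0 < d) (hn : d ≤ n) :
    (∑ k ∈ Finset.Iic d, n.choose k : ℝ) ≤ Real.exp (d * (1 + Real.log (n / d))) := by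
  have hd' : (0 : ℝ) < d := by exact_mod_cast hd
  have hn' : (0 : ℝ) < n := by exact_mod_cast hd.trans_le hn
  have hle : (d : ℝ) / n ≤ 1 := (div_le_one hn').2 (by exact_mod_cast hn)
  have h1 : (∑ k ∈ Finset.Iic d, n.choose k : ℝ) * (d / n) ^ d ≤ Real.exp d := by
    calc (∑ k ∈ Finset.Iic d, n.choose k : ℝ) * (d / n) ^ d
        ≤ ∑ k ∈ Finset.Iic d, (n.choose k : ℝ) * (d / n) ^ k := by
          rw [Finset.sum_mul]
          refine Finset.sum_le_sum fun k hk => mul_le_mul_of_nonneg_left ?_ (Nat.cast_nonneg _)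
          exact pow_le_pow_of_le_one (by positivity) hle (Finset.mem_Iic.1 hk)
      _ ≤ ∑ k ∈ Finset.range (n + 1), (n.choose k : ℝ) * (d / n) ^ k :=
          Finset.sum_le_sum_of_subset_of_nonneg
            (fun k hk => by simp at *; omega) fun _ _ _ => by positivity
      _ = (d / n + 1) ^ n := by
          rw [add_pow]
          exact Finset.sum_congr rfl fun k _ => by rw [one_pow]; ring
      _ ≤ Real.exp (d / n) ^ n := by
          gcongr
          exact Real.add_one_le_exp _
      _ = Real.exp d := by
          rw [← Real.exp_nat_mul]
          congr 1
          field_simp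
  have h2 : Real.exp (d * (1 + Real.log (n / d))) = Real.exp d * (n / d) ^ d := by
    rw [mul_add, mul_one, Real.exp_add, Real.exp_nat_mul, Real.exp_log (by positivity)]
  rw [h2]
  calc (∑ k ∈ Finset.Iic d, n.choose k : ℝ)
      = (∑ k ∈ Finset.Iic d, n.choose k : ℝ) * (d / n) ^ d * (n / d) ^ d := by
        rw [mul_assoc, ← mul_pow, div_mul_div_cancel₀ hn'.ne', div_self hd'.ne', one_pow, mul_one]
    _ ≤ _ := by gcongr

/-! ### The upper bound, and the final constants. -/

theorem regret_le {X : Type u} {H : Set (X → Bool)} {d n : ℕ} (hH : vcDim H = (d : ℕ∞))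
    (hd : 0 < d) (hn : d ≤ n) :
    regret H n ≤ 2 * √(n * (d * (1 + Real.log (n / d)))) := by
  obtain ⟨S, hS, hcard⟩ := exists_shatters_of_vcDim hH hd
  have hX : Nonempty X := ⟨(Finset.card_pos.1 (hcard ▸ hd)).choose⟩
  have hHne : H.Nonempty := by
    obtain ⟨h, hh, -⟩ := hS fun _ => true
    exact ⟨h, hh⟩
  have hd' : (0 : ℝ) < d := by exact_mod_cast hd
  have hlog : 0 ≤ Real.log ((n : ℝ) / d) :=
    Real.log_nonneg ((one_le_div hd').2 (by exact_mod_cast hn))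
  have hV (x : Fin n → X) : Real.log (patterns H x).card ≤ d * (1 + Real.log (n / d)) := by
    rw [Real.log_le_iff_le_exp (by exact_mod_cast Finset.card_pos.2 (patterns_nonempty hHne x))]
    exact le_trans (by exact_mod_cast card_patterns_le x hH) (sum_choose_le_exp hd hn)
  choose A hA using fun x : Fin n → X =>
    exists_forecast_regret_le (patterns H x) (by positivity) (hV x)
  refine regret_le_of_learner A H fun x y => ?_
  obtain ⟨h, hh⟩ : bestMistakes H x y ∈ Set.range fun h : H => hypothesisMistakes h.val x y :=
    have := hHne.to_subtype
    Nat.sInf_mem (Set.range_nonempty _)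
  rw [Learner.regret, ← hh]
  exact hA x (h.val ∘ x) (comp_mem_patterns h.2 x) y

end AgnosticTransductive

theorem mainTheorem3 :
    (∃ c : ℝ, 0 < c ∧
      ∀ (X : Type u) (H : Set (X → Bool)) (d n : ℕ),
        AgnosticTransductive.vcDim H = (d : ℕ∞) → 0 < d →
        (n : ℕ∞) ≤ ENat.card X →
        d ≤ n →
          c * Real.sqrt ((d : ℝ) * n) ≤ AgnosticTransductive.regret H n) ∧
    (∀ a : ℝ, 1 < a → ∃ C : ℝ, 0 < C ∧
      ∀ (X : Type u) (H : Set (X → Bool)) (d n : ℕ),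
        AgnosticTransductive.vcDim H = (d : ℕ∞) → 0 < d →
        (n : ℕ∞) ≤ ENat.card X →
        a * (d : ℝ) ≤ n →
          AgnosticTransductive.regret H n ≤
            C * Real.sqrt ((d : ℝ) * n * Real.log ((n : ℝ) / d))) := by
  refine ⟨⟨1 / 8, by norm_num, fun X H d n hH hd _ hn =>
    AgnosticTransductive.le_regret hH hd hn⟩, fun a ha => ?_⟩
  have hla : 0 < Real.log a := Real.log_pos ha
  -- From `n / d ≥ a` follows `1 ≤ log (n / d) / log a`, so `1 + log (n / d) ≤ (1 + 1 / log a) log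
  -- (n / d)`.
  refine ⟨2 * √(1 + 1 / Real.log a), by positivity, fun X H d n hH hd _ hn => ?_⟩
  have hd' : (0 : ℝ) < d := by exact_mod_cast hd
  have hdn : d ≤ n := by
    have : (d : ℝ) ≤ n := by nlinarith
    exact_mod_cast this
  have hlog : Real.log a ≤ Real.log (n / d) :=
    Real.log_le_log (by linarith) ((le_div_iff₀ hd').2 hn)
  have h1 : 1 ≤ 1 / Real.log a * Real.log (n / d) := by
    rw [one_div_mul_eq_div]
    exact (one_le_div hla).2 hlog
  refine (AgnosticTransductive.regret_le hH hd hdn).trans ?_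
  rw [mul_assoc, ← Real.sqrt_mul (by positivity)]
  refine mul_le_mul_of_nonneg_left (Real.sqrt_le_sqrt ?_) zero_le_two
  calc (n : ℝ) * (d * (1 + Real.log (n / d)))
      ≤ n * (d * (1 / Real.log a * Real.log (n / d) + Real.log (n / d))) := by gcongr
    _ = _ := by ring
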